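/- Let $m>1$ be an odd integer and let $$H_m=\langle x,y\mid \underbrace{xyxy\cdots yx}_{\text{length } m}=\underbrace{yxyx\cdots xy}_{\text{length } m}\rangle .$$ For $g\in H_m$ and a representation $\rho:H_m\to SL(2,\mathbb{C})$ put $\tau_g(\rho)=\operatorname{tr}\rho(g)$. The functions $\tau_x,\tau_y,\tau_{xy}$ generate the ring generated by all the $\tau_g$, and the $SL(2,\mathbb{C})$ character variety of $H_m$ is $$X(H_m)=\{(\tau_x(\rho),\tau_y(\rho),\tau_{xy}(\rho)) \mid \rho:H_m\to SL(2,\mathbb{C})\ \text{a homomorphism}\}\subseteq\mathbb{C}^3,$$ with coordinates $(X,Y,Z)$. Then $Y=X$ on $X(H_m)$, so that $(X,Y,Z)\mapsto(X,Z)$ identifies $X(H_m)$ with its image in the complex plane $\mathbb{C}^2$, and this image is $$\{(X,Z)\in\mathbb{C}^2 \mid Z=X^2-2\}\ \cup\bigcup_{w^m=1,\ w\neq 1}\{(X,Z)\in\mathbb{C}^2 \mid Z=-2\operatorname{Re}(w)\},$$ the union of the parabola $Z=X^2-2$ and of horizontal lines $Z=-2\operatorname{Re}(w)$, where $w\ne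 1$ runs over the $m$-th roots of unity. There are exactly $\frac{m-1}{2}$ distinct such lines. -/

import Mathlib

open scoped MatrixGroups

namespace TorusKnotCharacter

/-! ### `SL(2, ℂ)` character varieties -/

/-- The set `R(G)` of all representations of `G` in `SL(2, ℂ)`. -/
abbrev Rep (G : Type*) [Group G] : Type _ := G →* SL(2, ℂ)

/-- The trace function `τ_g : R(G) → ℂ`, `τ_g(ρ) = tr ρ(g)`. -/
def tau {G : Type*} [Group G] (g : G) : Rep G → ℂ :=
  fun ρ => Matrix.trace (ρ g : Matrix (Fin 2) (Fin 2) ℂ)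

/-- The ring `T` generated by all the functions `τ_g`, `g ∈ G`. -/
def traceRing (G : Type*) [Group G] : Subring (Rep G → ℂ) :=
  Subring.closure (Set.range (tau (G := G)))

/-- The functions `τ_{γ_i}` generate the ring `T`. -/
def GeneratesTraceRing {G : Type*} [Group G] {ι : Type*} (γ : ι → G) : Prop :=
  Subring.closure (Set.range fun i => tau (γ i)) = traceRing G

/-- The `SL(2, ℂ)` character variety `X(G) = t(R(G)) ⊆ ℂ^ι`, in the coordinates
`t(ρ) = (τ_{γ_i}(ρ))_i` given by a family `γ` whose trace functions generate `T`. -/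
def characterVariety {G : Type*} [Group G] {ι : Type*} (γ : ι → G)
    (_hγ : GeneratesTraceRing γ) : Set (ι → ℂ) :=
  Set.range fun (ρ : Rep G) (i : ι) => tau (γ i) ρ

/-! ### For a group generated by `x, y`, the functions `τ_x, τ_y, τ_{xy}` generate `T` -/

/-- The matrix valued functions on `R(G)` of the form `a + b ρ(x) + c ρ(y) + d ρ(x) ρ(y)`
with coefficients `a, b, c, d` in the ring `A`. -/
def matSpan {G : Type*} [Group G] (x y : G) (A : Subring (Rep G → ℂ)) :
    Set (Rep G → Matrix (Fin 2) (Fin 2) ℂ) :=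
  {M | ∃ a ∈ A, ∃ b ∈ A, ∃ c ∈ A, ∃ d ∈ A, ∀ ρ : Rep G,
    M ρ = a ρ • (1 : Matrix (Fin 2) (Fin 2) ℂ) + b ρ • (ρ x : Matrix (Fin 2) (Fin 2) ℂ)
      + c ρ • (ρ y : Matrix (Fin 2) (Fin 2) ℂ)
      + d ρ • ((ρ x : Matrix (Fin 2) (Fin 2) ℂ) * (ρ y : Matrix (Fin 2) (Fin 2) ℂ))}

theorem sl_mul_self (P : SL(2, ℂ)) :
    (P : Matrix (Fin 2) (Fin 2) ℂ) * P = Matrix.trace (P : Matrix (Fin 2) (Fin 2) ℂ) •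
      (P : Matrix (Fin 2) (Fin 2) ℂ) - 1 := by
  have h := P.det_coe
  rw [Matrix.det_fin_two] at h
  ext i j
  fin_cases i <;> fin_cases j <;>
    simp [Matrix.mul_apply, Fin.sum_univ_two, Matrix.trace_fin_two] <;>
    first | ring1 | linear_combination h | linear_combination -h

theorem sl_inv (P : SL(2, ℂ)) :
    ((P⁻¹ : SL(2, ℂ)) : Matrix (Fin 2) (Fin 2) ℂ) =
      Matrix.trace (P : Matrix (Fin 2) (Fin 2) ℂ) • (1 : Matrix (Fin 2) (Fin 2) ℂ) - P := by
  rw [Matrix.SpecialLinearGroup.coe_inv, Matrix.adjugate_fin_two]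
  ext i j
  fin_cases i <;> fin_cases j <;> simp [Matrix.trace_fin_two]

theorem mat_swap (P Q : Matrix (Fin 2) (Fin 2) ℂ) :
    Q * P = -(P * Q) + P.trace • Q + Q.trace • P
      + ((P * Q).trace - P.trace * Q.trace) • (1 : Matrix (Fin 2) (Fin 2) ℂ) := by
  ext i j
  fin_cases i <;> fin_cases j <;>
    simp [Matrix.mul_apply, Fin.sum_univ_two, Matrix.trace_fin_two] <;> ring

theorem generatesTraceRing_of_closure {G : Type*} [Group G] (x y : G)
    (hxy : Subgroup.closure {x, y} = ⊤) : GeneratesTraceRing ![x, y, x * y] := by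
  unfold GeneratesTraceRing
  set A := Subring.closure (Set.range fun i => tau (![x, y, x * y] i)) with hA
  have hx : tau x ∈ A := Subring.subset_closure ⟨0, rfl⟩
  have hy : tau y ∈ A := Subring.subset_closure ⟨1, rfl⟩
  have hz : tau (x * y) ∈ A := Subring.subset_closure ⟨2, rfl⟩
  have mulx : ∀ M ∈ matSpan x y A,
      (fun ρ => M ρ * (ρ x : Matrix (Fin 2) (Fin 2) ℂ)) ∈ matSpan x y A := by
    rintro M ⟨a, ha, b, hb, c, hc, d, hd, h⟩
    refine ⟨-b + c * (tau (x * y) - tau x * tau y) - d * tau y, ?_,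
      a + b * tau x + c * tau y + d * tau (x * y), ?_, c * tau x + d, ?_, -c, ?_, ?_⟩
    · exact sub_mem (add_mem (neg_mem hb) (mul_mem hc (sub_mem hz (mul_mem hx hy))))
        (mul_mem hd hy)
    · exact add_mem (add_mem (add_mem ha (mul_mem hb hx)) (mul_mem hc hy)) (mul_mem hd hz)
    · exact add_mem (mul_mem hc hx) hd
    · exact neg_mem hc
    · intro ρ
      have h1 := sl_mul_self (ρ x)
      have h2 := mat_swap (ρ x : Matrix (Fin 2) (Fin 2) ℂ) (ρ y)
      simp only [h ρ, add_mul, smul_mul_assoc, one_mul, mul_assoc, h1, h2, mul_add, mul_sub,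
        mul_neg, ← mul_assoc (ρ x : Matrix (Fin 2) (Fin 2) ℂ) (ρ x), sub_mul, mul_smul_comm,
        mul_one, tau, map_mul, Matrix.SpecialLinearGroup.coe_mul, Pi.add_apply, Pi.sub_apply,
        Pi.neg_apply, Pi.mul_apply]
      module
  have muly : ∀ M ∈ matSpan x y A,
      (fun ρ => M ρ * (ρ y : Matrix (Fin 2) (Fin 2) ℂ)) ∈ matSpan x y A := by
    rintro M ⟨a, ha, b, hb, c, hc, d, hd, h⟩
    refine ⟨-c, neg_mem hc, -d, neg_mem hd, a + c * tau y, add_mem ha (mul_mem hc hy),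
      b + d * tau y, add_mem hb (mul_mem hd hy), ?_⟩
    intro ρ
    have h1 := sl_mul_self (ρ y)
    simp only [h ρ, add_mul, smul_mul_assoc, one_mul, mul_assoc, h1, mul_sub, mul_smul_comm,
      mul_one, tau, Pi.add_apply, Pi.neg_apply, Pi.mul_apply]
    module
  have comb : ∀ t ∈ A, ∀ M ∈ matSpan x y A, ∀ N ∈ matSpan x y A,
      (fun ρ => t ρ • M ρ - N ρ) ∈ matSpan x y A := by
    rintro t ht M ⟨a, ha, b, hb, c, hc, d, hd, h⟩ N ⟨a', ha', b', hb', c', hc', d', hd', h'⟩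
    refine ⟨t * a - a', sub_mem (mul_mem ht ha) ha', t * b - b', sub_mem (mul_mem ht hb) hb',
      t * c - c', sub_mem (mul_mem ht hc) hc', t * d - d', sub_mem (mul_mem ht hd) hd', ?_⟩
    intro ρ
    simp only [h ρ, h' ρ, Pi.sub_apply, Pi.mul_apply]
    module
  have key : ∀ g : G, (fun ρ : Rep G => (ρ g : Matrix (Fin 2) (Fin 2) ℂ)) ∈ matSpan x y A := by
    intro g
    have hg : g ∈ Subgroup.closure {x, y} := by rw [hxy]; trivial
    induction hg using Subgroup.closure_induction_right with
    | one =>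
      exact ⟨1, one_mem A, 0, zero_mem A, 0, zero_mem A, 0, zero_mem A, fun ρ => by simp⟩
    | mul_right g _ s hs ih =>
      rcases hs with rfl | rfl
      · simpa using mulx _ ih
      · simpa using muly _ ih
    | mul_inv_cancel g _ s hs ih =>
      rcases hs with rfl | rfl
      · have := comb _ hx _ ih _ (mulx _ ih)
        convert this using 2 with ρ
        rw [map_mul, map_inv, Matrix.SpecialLinearGroup.coe_mul, sl_inv]
        simp [mul_sub, tau]
      · have := comb _ hy _ ih _ (muly _ ih)
        convert this using 2 with ρ
        rw [map_mul, map_inv, Matrix.SpecialLinearGroup.coe_mul, sl_inv]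
        simp [mul_sub, tau]
  apply le_antisymm
  · refine Subring.closure_mono ?_
    rintro _ ⟨i, rfl⟩
    exact ⟨_, rfl⟩
  · refine Subring.closure_le.2 ?_
    rintro _ ⟨g, rfl⟩
    obtain ⟨a, ha, b, hb, c, hc, d, hd, h⟩ := key g
    have : tau g = a * (1 + 1) + b * tau x + c * tau y + d * tau (x * y) := by
      funext ρ
      have := congrArg Matrix.trace (h ρ)
      simp only [Matrix.trace_add, Matrix.trace_smul, Matrix.trace_one, smul_eq_mul] at this
      simp only [tau, Pi.add_apply, Pi.mul_apply, Pi.one_apply, map_mul,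
        Matrix.SpecialLinearGroup.coe_mul]
      rw [this]
      norm_num
    rw [this]
    exact add_mem (add_mem (add_mem (mul_mem ha (add_mem (one_mem A) (one_mem A)))
      (mul_mem hb hx)) (mul_mem hc hy)) (mul_mem hd hz)

/-! ### The groups `H_m` -/

/-- The alternating word `a b a b …` of length `n`, starting with `a`. -/
def altWord {G : Type*} [Group G] (a b : G) : ℕ → G
  | 0 => 1
  | n + 1 => a * altWord b a n

/-- The relator of `H_m`: the alternating word of length `m` starting with `x`, times the inverse
of the alternating word of length `m` starting with `y`, where `x, y` are the free generators. -/
def relators (m : ℕ) : Set (FreeGroup (Fin 2)) :=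
  {altWord (FreeGroup.of 0) (FreeGroup.of 1) m *
    (altWord (FreeGroup.of 1) (FreeGroup.of 0) m)⁻¹}

/-- `H_m = ⟨x, y | xyxy⋯ = yxyx⋯⟩`, both words having length `m`. For odd `m` the relation
reads `xyxy⋯yx = yxyx⋯xy`. -/
abbrev H (m : ℕ) : Type := PresentedGroup (relators m)

/-- The generator `x` of `H_m`. -/
def genX (m : ℕ) : H m := PresentedGroup.of 0

/-- The generator `y` of `H_m`. -/
def genY (m : ℕ) : H m := PresentedGroup.of 1

theorem H_generates (m : ℕ) : GeneratesTraceRing ![genX m, genY m, genX m * genY m] := by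
  apply generatesTraceRing_of_closure
  rw [← PresentedGroup.closure_range_of (relators m)]
  congr 1
  ext g
  simp [Fin.exists_fin_two, genX, genY, eq_comm]

/-- The character variety `X(H_m) ⊆ ℂ³` in the coordinates
`(X, Y, Z) = (τ_x, τ_y, τ_{xy})`. -/
def XH (m : ℕ) : Set (Fin 3 → ℂ) :=
  characterVariety ![genX m, genY m, genX m * genY m] (H_generates m)

/-! ### Curves in the plane with coordinates `(X, Z)` -/

/-- The parabola `Z = X² - 2`. -/
def parabola : Set (ℂ × ℂ) := {p | p.2 = p.1 ^ 2 - 2}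

/-- The horizontal line `Z = c`. -/
def horizontalLine (c : ℂ) : Set (ℂ × ℂ) := {p | p.2 = c}

/-- The set of all the lines `Z = -2 Re(w)`, where `w ≠ 1` is an `m`-th root of unity. -/
def rootLines (m : ℕ) : Set (Set (ℂ × ℂ)) :=
  {L | ∃ w : ℂ, w ^ m = 1 ∧ w ≠ 1 ∧ L = horizontalLine ((-2 * w.re : ℝ) : ℂ)}

end TorusKnotCharacter

namespace TorusKnotCharacter

/-! ### Alternating words -/

/-! Write m = 2n+1, so a representation is a pair A, B with (AB)ⁿA = (BA)ⁿB. This makes A and B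
conjugate (`trace_eq_of_relation`), hence Y = X. For equal traces, Cayley–Hamilton turns the
difference of the two sides into a scalar multiple of A - B, the scalar depending only on Z = tr AB
(`relation_sub`). So either A = B, which gives the parabola, or Z is a zero of `relCoeff`.

Putting Z = q + q⁻¹ makes that polynomial (q^m + 1)/((q + 1)qⁿ) for q ≠ -1, so with w = -q its zeros
are the heights of the lines (`relCoeff_eq_zero_iff`). Every pair (X, Z) comes from some A, B of
equal trace X (`exists_sl_trace`), so the lines are attained in full.

The lines are counted by choosing one w from each conjugate pair and using injectivity of cosine on
[0, π]. -/

theorem altWord_two_mul_add_one {G : Type*} [Group G] (a b : G) (n : ℕ) :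
    altWord a b (2 * n + 1) = (a * b) ^ n * a := by
  induction n with
  | zero => simp [altWord]
  | succ n ih =>
    rw [show 2 * (n + 1) + 1 = (2 * n + 1) + 1 + 1 by ring, altWord, altWord, ih, pow_succ']
    simp only [mul_assoc]

theorem map_altWord {G K : Type*} [Group G] [Group K] (f : G →* K) (a b : G) (n : ℕ) :
    f (altWord a b n) = altWord (f a) (f b) n := by
  induction n generalizing a b with
  | zero => simp [altWord]
  | succ n ih => simp [altWord, ih]

theorem H_relation (n : ℕ) :
    (genX (2 * n + 1) * genY (2 * n + 1)) ^ n * genX (2 * n + 1) =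
      (genY (2 * n + 1) * genX (2 * n + 1)) ^ n * genY (2 * n + 1) := by
  have h : PresentedGroup.mk (relators (2 * n + 1)) (altWord (FreeGroup.of 0) (FreeGroup.of 1)
      (2 * n + 1) * (altWord (FreeGroup.of 1) (FreeGroup.of 0) (2 * n + 1))⁻¹) = 1 :=
    PresentedGroup.one_of_mem rfl
  rw [map_mul, map_inv, mul_inv_eq_one, map_altWord, map_altWord, altWord_two_mul_add_one,
    altWord_two_mul_add_one] at h
  exact h

theorem exists_rep_of_relation {n : ℕ} {A B : SL(2, ℂ)}
    (h : (A * B) ^ n * A = (B * A) ^ n * B) :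
    ∃ ρ : Rep (H (2 * n + 1)), ρ (genX _) = A ∧ ρ (genY _) = B := by
  have hr : ∀ r ∈ relators (2 * n + 1), FreeGroup.lift ![A, B] r = 1 := by
    rintro r rfl
    rw [map_mul, map_inv, mul_inv_eq_one, map_altWord, map_altWord]
    simpa [altWord_two_mul_add_one] using h
  exact ⟨PresentedGroup.toGroup hr, PresentedGroup.toGroup.of hr, PresentedGroup.toGroup.of hr⟩

/-! ### The polynomial factoring the relation -/

/-- The sequence `1, z - 1, …` with `d (n + 2) = z d (n + 1) - d n`, for which
`(AB)ⁿA - (BA)ⁿB = d n (A - B)` when `tr A = tr B` and `z = tr AB`. -/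
def relCoeff (z : ℂ) : ℕ → ℂ
  | 0 => 1
  | 1 => z - 1
  | n + 2 => z * relCoeff z (n + 1) - relCoeff z n

theorem pow_add_two_mul (C : SL(2, ℂ)) (D : Matrix (Fin 2) (Fin 2) ℂ) (n : ℕ) :
    (C : Matrix (Fin 2) (Fin 2) ℂ) ^ (n + 2) * D =
      Matrix.trace (C : Matrix (Fin 2) (Fin 2) ℂ) • ((C : Matrix (Fin 2) (Fin 2) ℂ) ^ (n + 1) * D)
        - (C : Matrix (Fin 2) (Fin 2) ℂ) ^ n * D := by
  rw [pow_add, pow_two, sl_mul_self, pow_succ, mul_sub, mul_one, sub_mul, mul_smul_comm,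
    smul_mul_assoc]

/-- Cayley–Hamilton gives (AB)⁻¹ = tr(AB) - AB; multiply by A on the right and expand B⁻¹ = tr B -
B. -/
theorem mul_mul_self (A B : SL(2, ℂ)) :
    (A * B * A : Matrix (Fin 2) (Fin 2) ℂ) =
      Matrix.trace (A * B : Matrix (Fin 2) (Fin 2) ℂ) • (A : Matrix (Fin 2) (Fin 2) ℂ)
        + (B : Matrix (Fin 2) (Fin 2) ℂ) - Matrix.trace (B : Matrix (Fin 2) (Fin 2) ℂ) • 1 := by
  have h := sl_inv (A * B)
  have h' := congrArg (· * (A : Matrix (Fin 2) (Fin 2) ℂ)) h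
  simp only [← Matrix.SpecialLinearGroup.coe_mul, mul_inv_rev, inv_mul_cancel_right, sub_mul,
    smul_mul_assoc, one_mul, sl_inv B] at h'
  simp only [← Matrix.SpecialLinearGroup.coe_mul]
  rw [sub_eq_sub_iff_add_eq_add] at h'
  rw [eq_sub_iff_add_eq, ← h']
  abel

/-- Since tr AB = tr BA, both sides satisfy the recurrence of `relCoeff`. Equality of traces enters
at n = 1, where the scalar terms must cancel. -/
theorem relation_sub (A B : SL(2, ℂ))
    (hAB : Matrix.trace (A : Matrix (Fin 2) (Fin 2) ℂ) = Matrix.trace (B : Matrix (Fin 2) (Fin 2) ℂ))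
    (n : ℕ) :
    (((A * B) ^ n * A : SL(2, ℂ)) : Matrix (Fin 2) (Fin 2) ℂ) - ((B * A) ^ n * B : SL(2, ℂ)) =
      relCoeff (Matrix.trace (A * B : Matrix (Fin 2) (Fin 2) ℂ)) n •
        ((A : Matrix (Fin 2) (Fin 2) ℂ) - B) := by
  induction n using Nat.twoStepInduction with
  | zero => simp [relCoeff]
  | one =>
    simp only [pow_one, Matrix.SpecialLinearGroup.coe_mul, relCoeff, mul_mul_self, hAB,
      Matrix.trace_mul_comm (B : Matrix (Fin 2) (Fin 2) ℂ)]
    module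
  | more n ih1 ih2 =>
    simp only [Matrix.SpecialLinearGroup.coe_mul, Matrix.SpecialLinearGroup.coe_pow] at ih1 ih2 ⊢
    have h1 := pow_add_two_mul (A * B) A n
    have h2 := pow_add_two_mul (B * A) B n
    rw [Matrix.SpecialLinearGroup.coe_mul] at h1 h2
    rw [Matrix.trace_mul_comm (B : Matrix (Fin 2) (Fin 2) ℂ)] at h2
    rw [h1, h2, sub_sub_sub_comm, ← smul_sub, ih1, ih2, relCoeff]
    module

theorem relCoeff_add_inv {q : ℂ} (hq : q ≠ 0) (n : ℕ) :
    (q + 1) * q ^ n * relCoeff (q + q⁻¹) n = q ^ (2 * n + 1) + 1 := by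
  induction n using Nat.twoStepInduction with
  | zero => simp [relCoeff]
  | one => simp only [relCoeff]; field_simp; ring
  | more n ih1 ih2 =>
    have hc : q * (q + q⁻¹) = q ^ 2 + 1 := by field_simp
    rw [relCoeff]
    linear_combination (q * (q + q⁻¹)) * ih2 - q ^ 2 * ih1 + (q ^ (2 * (n + 1) + 1) + 1) * hc

/-- Covers q = -1, where `relCoeff_add_inv` degenerates to 0 = 0; nonvanishing here is what excludes
w = 1. -/
theorem relCoeff_neg_two (n : ℕ) : relCoeff (-2) n = (-1) ^ n * (2 * n + 1) := by
  induction n using Nat.twoStepInduction with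
  | zero => simp [relCoeff]
  | one => norm_num [relCoeff]
  | more n ih1 ih2 =>
    rw [relCoeff, ih1, ih2]
    push_cast
    ring

theorem exists_add_inv (z : ℂ) : ∃ q : ℂ, q ≠ 0 ∧ z = q + q⁻¹ := by
  obtain ⟨s, hs⟩ := IsAlgClosed.exists_eq_mul_self (discrim 1 (-z) 1)
  obtain ⟨q, hq⟩ := exists_quadratic_eq_zero one_ne_zero ⟨s, hs⟩
  have h0 : q ≠ 0 := by
    rintro rfl
    simp at hq
  refine ⟨q, h0, ?_⟩
  field_simp
  linear_combination -hq

/-- A root of unity has modulus 1, so its inverse is its conjugate. -/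
theorem neg_two_re_of_pow_eq_one {m : ℕ} (hm : m ≠ 0) {w : ℂ} (hw : w ^ m = 1) :
    ((-2 * w.re : ℝ) : ℂ) = -w + (-w)⁻¹ := by
  have hn := Complex.norm_eq_one_of_pow_eq_one hw hm
  rw [inv_neg, Complex.inv_eq_conj hn]
  apply Complex.ext <;> simp
  ring

theorem relCoeff_eq_zero_iff (z : ℂ) (n : ℕ) :
    relCoeff z n = 0 ↔
      ∃ w : ℂ, w ^ (2 * n + 1) = 1 ∧ w ≠ 1 ∧ z = ((-2 * w.re : ℝ) : ℂ) := by
  have hodd : Odd (2 * n + 1) := odd_two_mul_add_one n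
  constructor
  · intro h
    obtain ⟨q, hq, rfl⟩ := exists_add_inv z
    have h1 := relCoeff_add_inv hq n
    rw [h, mul_zero] at h1
    have hw : (-q) ^ (2 * n + 1) = 1 := by
      rw [hodd.neg_pow]
      linear_combination h1
    refine ⟨-q, hw, ?_, ?_⟩
    · intro h2
      obtain rfl : q = -1 := by rw [← h2, neg_neg]
      rw [show (-1 : ℂ) + (-1)⁻¹ = -2 by norm_num, relCoeff_neg_two] at h
      have h3 : (2 * n + 1 : ℂ) = 0 := by simpa using h
      exact Nat.cast_ne_zero.2 (Nat.succ_ne_zero (2 * n)) (by rw [← h3]; push_cast; rfl)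
    · rw [neg_two_re_of_pow_eq_one hodd.pos.ne' hw, neg_neg]
  · rintro ⟨w, hw, hw1, rfl⟩
    have hw0 : w ≠ 0 := by
      rintro rfl
      simp at hw
    rw [neg_two_re_of_pow_eq_one hodd.pos.ne' hw]
    have h1 := relCoeff_add_inv (neg_ne_zero.2 hw0) n
    rw [hodd.neg_pow, hw, neg_add_cancel] at h1
    refine (mul_eq_zero.1 h1).resolve_left (mul_ne_zero ?_ (pow_ne_zero _ (neg_ne_zero.2 hw0)))
    intro h
    exact hw1 (by linear_combination -h)

/-! ### The character variety of `H_m` -/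

theorem exists_sl_trace (x z : ℂ) :
    ∃ A B : SL(2, ℂ), Matrix.trace (A : Matrix (Fin 2) (Fin 2) ℂ) = x ∧
      Matrix.trace (B : Matrix (Fin 2) (Fin 2) ℂ) = x ∧
      Matrix.trace (A * B : Matrix (Fin 2) (Fin 2) ℂ) = z := by
  obtain ⟨q, hq, rfl⟩ := exists_add_inv z
  -- The product is upper triangular with diagonal q⁻¹, q.
  refine ⟨⟨!![x, -1; 1, 0], by simp [Matrix.det_fin_two]⟩,
    ⟨!![0, q; -q⁻¹, x], by simp [Matrix.det_fin_two, hq]⟩, ?_, ?_, ?_⟩ <;>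
  simp [Matrix.trace_fin_two]
  ring

theorem mem_XH_iff {n : ℕ} {v : Fin 3 → ℂ} :
    v ∈ XH (2 * n + 1) ↔ ∃ A B : SL(2, ℂ), (A * B) ^ n * A = (B * A) ^ n * B ∧
      Matrix.trace (A : Matrix (Fin 2) (Fin 2) ℂ) = v 0 ∧
      Matrix.trace (B : Matrix (Fin 2) (Fin 2) ℂ) = v 1 ∧
      Matrix.trace (A * B : Matrix (Fin 2) (Fin 2) ℂ) = v 2 := by
  constructor
  · rintro ⟨ρ, rfl⟩
    refine ⟨ρ (genX _), ρ (genY _), ?_, rfl, rfl, ?_⟩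
    · simpa using congrArg ρ (H_relation n)
    · simp [tau]
  · rintro ⟨A, B, h, h0, h1, h2⟩
    obtain ⟨ρ, rfl, rfl⟩ := exists_rep_of_relation h
    refine ⟨ρ, ?_⟩
    funext i
    fin_cases i
    · exact h0
    · exact h1
    · simpa [tau] using h2

/-- The right side is also B(AB)ⁿ, so (AB)ⁿ conjugates B to A. -/
theorem trace_eq_of_relation {n : ℕ} {A B : SL(2, ℂ)} (h : (A * B) ^ n * A = (B * A) ^ n * B) :
    Matrix.trace (A : Matrix (Fin 2) (Fin 2) ℂ) = Matrix.trace (B : Matrix (Fin 2) (Fin 2) ℂ) := by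
  have hB : (B * A) ^ n * B = B * (A * B) ^ n := by
    have : SemiconjBy B (A * B) (B * A) := (mul_assoc B A B).symm
    exact (this.pow_right n).eq.symm
  have hA : A = ((A * B) ^ n)⁻¹ * (B * (A * B) ^ n) := by
    rw [← hB, ← h, inv_mul_cancel_left]
  rw [hA, Matrix.SpecialLinearGroup.coe_mul, Matrix.trace_mul_comm,
    ← Matrix.SpecialLinearGroup.coe_mul,
    mul_inv_cancel_right]

theorem trace_mul_self (A : SL(2, ℂ)) :
    Matrix.trace (A * A : Matrix (Fin 2) (Fin 2) ℂ) =
      Matrix.trace (A : Matrix (Fin 2) (Fin 2) ℂ) ^ 2 - 2 := by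
  rw [sl_mul_self, Matrix.trace_sub, Matrix.trace_smul, Matrix.trace_one, smul_eq_mul, pow_two]
  simp

theorem relation_iff {n : ℕ} {A B : SL(2, ℂ)}
    (hAB : Matrix.trace (A : Matrix (Fin 2) (Fin 2) ℂ) = Matrix.trace (B : Matrix (Fin 2) (Fin 2) ℂ)) :
    (A * B) ^ n * A = (B * A) ^ n * B ↔
      relCoeff (Matrix.trace (A * B : Matrix (Fin 2) (Fin 2) ℂ)) n = 0 ∨ A = B := by
  have hcoe (P Q : SL(2, ℂ)) : P = Q ↔ (P : Matrix (Fin 2) (Fin 2) ℂ) = Q := Subtype.ext_iff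
  rw [hcoe, ← sub_eq_zero, relation_sub A B hAB, smul_eq_zero, sub_eq_zero, ← hcoe]

theorem image_XH (n : ℕ) :
    (fun v : Fin 3 → ℂ => (v 0, v 2)) '' XH (2 * n + 1) =
      parabola ∪ ⋃₀ rootLines (2 * n + 1) := by
  have hlines (p : ℂ × ℂ) : p ∈ ⋃₀ rootLines (2 * n + 1) ↔ relCoeff p.2 n = 0 := by
    rw [relCoeff_eq_zero_iff]
    constructor
    · rintro ⟨_, ⟨w, hw, hw1, rfl⟩, hp⟩
      exact ⟨w, hw, hw1, hp⟩
    · rintro ⟨w, hw, hw1, hp⟩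
      exact ⟨_, ⟨w, hw, hw1, rfl⟩, hp⟩
  ext p
  rw [Set.mem_union, hlines]
  constructor
  · rintro ⟨v, hv, rfl⟩
    obtain ⟨A, B, h, h0, h1, h2⟩ := mem_XH_iff.1 hv
    rcases (relation_iff (trace_eq_of_relation h)).1 h with h | rfl
    · exact Or.inr (by rwa [h2] at h)
    · left
      change v 2 = v 0 ^ 2 - 2
      rw [← h2, ← h0, trace_mul_self]
  · intro hp
    obtain ⟨A, B, h0, h1, h2, h⟩ : ∃ A B : SL(2, ℂ),
        Matrix.trace (A : Matrix (Fin 2) (Fin 2) ℂ) = p.1 ∧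
        Matrix.trace (B : Matrix (Fin 2) (Fin 2) ℂ) = p.1 ∧
        Matrix.trace (A * B : Matrix (Fin 2) (Fin 2) ℂ) = p.2 ∧
        (A * B) ^ n * A = (B * A) ^ n * B := by
      rcases hp with hp | hp
      -- Only a matrix of trace X is needed; the value 0 is arbitrary.
      · obtain ⟨A, _, h0, -, -⟩ := exists_sl_trace p.1 0
        exact ⟨A, A, h0, h0, by rw [trace_mul_self, h0]; exact hp.symm, rfl⟩
      · obtain ⟨A, B, h0, h1, h2⟩ := exists_sl_trace p.1 p.2
        exact ⟨A, B, h0, h1, h2, (relation_iff (h0.trans h1.symm)).2 (Or.inl (by rwa [h2]))⟩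
    exact ⟨![p.1, p.1, p.2], mem_XH_iff.2 ⟨A, B, h, h0, h1, h2⟩, rfl⟩

/-! ### The number of lines -/

theorem horizontalLine_injective : Function.Injective horizontalLine := by
  intro c d h
  have : ((0, c) : ℂ × ℂ) ∈ horizontalLine d := h ▸ rfl
  exact this

theorem rootLines_eq_image (n : ℕ) :
    rootLines (2 * n + 1) =
      (fun k : ℕ => horizontalLine
        ((-2 * Real.cos (2 * Real.pi * k / (2 * n + 1 : ℕ)) : ℝ) : ℂ)) '' Set.Icc 1 n := by
  have hm : (2 * n + 1 : ℕ) ≠ 0 := by omega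
  have hre (k : ℕ) : (Complex.exp (2 * Real.pi * Complex.I / (2 * n + 1 : ℕ)) ^ k).re =
      Real.cos (2 * Real.pi * k / (2 * n + 1 : ℕ)) := by
    rw [← Complex.exp_nat_mul, ← Complex.exp_ofReal_mul_I_re]
    congr 2
    push_cast
    ring
  have hprim := Complex.isPrimitiveRoot_exp (2 * n + 1) hm
  ext L
  constructor
  · rintro ⟨w, hw, hw1, rfl⟩
    obtain ⟨k, hk, rfl⟩ := hprim.eq_pow_of_pow_eq_one hw
    have hk0 : k ≠ 0 := by
      rintro rfl
      simp at hw1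
    by_cases hkn : k ≤ n
    · exact ⟨k, ⟨by omega, hkn⟩, by simp only [hre]⟩
    -- Replace w by its conjugate, which has the same real part.
    · refine ⟨2 * n + 1 - k, ⟨by omega, by omega⟩, ?_⟩
      have hcos : Real.cos (2 * Real.pi * (2 * n + 1 - k : ℕ) / (2 * n + 1 : ℕ)) =
          Real.cos (2 * Real.pi * k / (2 * n + 1 : ℕ)) := by
        rw [← Real.cos_two_pi_sub, Nat.cast_sub hk.le]
        congr 1
        field_simp
        ring
      simp only [hre, hcos]
  · rintro ⟨k, ⟨hk1, hkn⟩, rfl⟩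
    refine ⟨Complex.exp (2 * Real.pi * Complex.I / (2 * n + 1 : ℕ)) ^ k, ?_,
      hprim.pow_ne_one_of_pos_of_lt (by omega) (by omega), by simp only [hre]⟩
    rw [← pow_mul, mul_comm k, pow_mul, hprim.pow_eq_one, one_pow]

theorem ncard_rootLines (n : ℕ) : (rootLines (2 * n + 1)).ncard = n := by
  rw [rootLines_eq_image, Set.InjOn.ncard_image, Set.ncard_eq_toFinset_card']
  · simp
  have hm : (0 : ℝ) < (2 * n + 1 : ℕ) := by positivity
  -- For k ≤ n the angle stays in [0, π], where cosine is injective.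
  have hmem (k : ℕ) (hk : k ∈ Set.Icc 1 n) :
      2 * Real.pi * k / (2 * n + 1 : ℕ) ∈ Set.Icc 0 Real.pi := by
    refine ⟨by positivity, ?_⟩
    have hk' : (k : ℝ) ≤ n := Nat.cast_le.2 hk.2
    rw [div_le_iff₀ hm]
    push_cast
    nlinarith [Real.pi_pos]
  intro k hk l hl h
  have h1 := Complex.ofReal_injective (horizontalLine_injective h)
  have h2 := Real.injOn_cos (hmem k hk) (hmem l hl) (by linarith)
  rw [div_left_inj' hm.ne'] at h2
  exact Nat.cast_injective (mul_left_cancel₀ Real.two_pi_pos.ne' h2)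

end TorusKnotCharacter

theorem mainTheorem2 (m : ℕ) (hm : 1 < m) (hodd : Odd m) :
    (∀ v ∈ TorusKnotCharacter.XH m, v 1 = v 0) ∧
    (fun v : Fin 3 → ℂ => (v 0, v 2)) '' TorusKnotCharacter.XH m =
      TorusKnotCharacter.parabola ∪ ⋃₀ TorusKnotCharacter.rootLines m ∧
    (TorusKnotCharacter.rootLines m).ncard = (m - 1) / 2 := by
  obtain ⟨n, rfl⟩ := hodd
  refine ⟨fun v hv => ?_, TorusKnotCharacter.image_XH n, ?_⟩
  · obtain ⟨A, B, h, h0, h1, -⟩ := TorusKnotCharacter.mem_XH_iff.1 hv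
    rw [← h0, ← h1, TorusKnotCharacter.trace_eq_of_relation h]
  · rw [TorusKnotCharacter.ncard_rootLines]
    omega
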